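/- Let $G=(V,E)$ be a finite or locally finite (simple, undirected, not necessarily connected) graph with weights $w_{xy}>0$ for $y\sim x$ (not necessarily symmetric) and a vertex measure $\mu:V\to(0,\infty)$. Put $\deg(x)=\sum_{y\sim x}w_{xy}$, $$\Delta f(x)=\frac1{\mu(x)}\sum_{y\sim x}w_{xy}(f(y)-f(x)),\qquad 2\Gamma(f,g)(x)=\frac1{\mu(x)}\sum_{y\sim x}w_{xy}(f(y)-f(x))(g(y)-g(x)),$$ $\Gamma(f)=\Gamma(f,f)$ and $2\Gamma_2(f)=\Delta\Gamma(f)-2\Gamma(f,\Delta f)$. For $n>0$ and $\kappa\in\mathbb R$, the graph satisfies $CDE(n,\kappa)$ if for every $x\in V$ and every $f:V\to(0,\infty)$ with $\Delta f(x)<0$, $$\Gamma_2(f)(x)-\Gamma\Big(f,\frac{\Gamma(f)}{f}\Big)(x)\ \ge\ \frac1n(\Delta f(x))^2+\kappa\,\Gamma(f)(x).$$ Assume that $D_\mu=\sup_{x\in V}\deg(x)/\mu(x)<\infty$ and $D_w=\sup_{x\in V,\,y\sim x}\deg(x)/w_{xy}<\infty$ (with $D_w=0$ if there are no edges), and that $G$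 satisfies $CDE(n,-K)$ for some real $n>0$, $K>0$. Let $x_0\in V$, $R>1$, and let $u(x,t)>0$ be defined for $x\in V$, $t>0$, such that $\partial_tu(x,t)=\Delta u(x,t)$ for all $t>0$ and all $x$ with graph distance $d(x_0,x)<2R$ (no equation is required elsewhere). Then for every $0<\alpha<1$, every $t>0$ and every $x$ with $d(x_0,x)\le R$, at $(x,t)$, $$\frac{(1-\alpha)\Gamma(\sqrt u)}{u}-\frac{\partial_t\sqrt u}{\sqrt u}\le\min\left\{D_\mu,\ \frac{n}{2(1-\alpha)t}+\frac{n(2+D_w)D_\mu}{(1-\alpha)R}+\frac{Kn}{2\alpha}\right\}.$$ -/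

import Mathlib

noncomputable section

namespace WGraph

variable {V : Type*} (G : SimpleGraph V) [G.LocallyFinite] (w : V → V → ℝ) (μ : V → ℝ)

/-- The weighted degree `deg(x) = ∑_{y ∼ x} w_{xy}`. -/
def deg (x : V) : ℝ := ∑ y ∈ G.neighborFinset x, w x y

/-- The `μ`-Laplacian `Δf(x) = (1/μ(x)) ∑_{y ∼ x} w_{xy} (f(y) - f(x))`. -/
def lap (f : V → ℝ) (x : V) : ℝ :=
  (1 / μ x) * ∑ y ∈ G.neighborFinset x, w x y * (f y - f x)

/-- The gradient form, `2Γ(f,g)(x) = (1/μ(x)) ∑_{y ∼ x} w_{xy} (f(y) - f(x)) (g(y) - g(x))`. -/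
def Gam (f g : V → ℝ) (x : V) : ℝ :=
  (1 / 2) * ((1 / μ x) * ∑ y ∈ G.neighborFinset x, w x y * ((f y - f x) * (g y - g x)))

/-- The iterated gradient form, `2Γ₂(f) = ΔΓ(f) - 2Γ(f, Δf)`. -/
def Gam2 (f : V → ℝ) (x : V) : ℝ :=
  (1 / 2) * lap G w μ (Gam G w μ f f) x - Gam G w μ f (lap G w μ f) x

/-- The modified iterated gradient form `Γ₂(f) - Γ(f, Γ(f)/f)`, for positive `f`. -/
def Gam2Tilde (f : V → ℝ) (x : V) : ℝ :=
  Gam2 G w μ f x - Gam G w μ f (fun y => Gam G w μ f f y / f y) x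

/-- The exponential curvature-dimension inequality `CDE(n, κ)`: at every vertex `x` and for every
positive function `f` on `V` with `Δf(x) < 0`,
`Γ₂(f)(x) - Γ(f, Γ(f)/f)(x) ≥ (1/n) (Δf(x))² + κ Γ(f)(x)`. -/
def CDE (n κ : ℝ) : Prop :=
  ∀ x : V, ∀ f : V → ℝ, (∀ y, 0 < f y) → lap G w μ f x < 0 →
    (1 / n) * (lap G w μ f x) ^ 2 + κ * Gam G w μ f f x ≤ Gam2Tilde G w μ f x

/-- The quotients `deg(x)/μ(x)`, `x ∈ V`. -/
def degMuRatios : Set ℝ := {r | ∃ x : V, r = deg G w x / μ x}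

/-- `D_μ = sup_x deg(x)/μ(x)`. -/
def Dmu : ℝ := sSup (degMuRatios G w μ)

/-- The quotients `deg(x)/w_{xy}`, `x ∈ V`, `y ∼ x`. -/
def degWRatios : Set ℝ := {r | ∃ x y : V, G.Adj x y ∧ r = deg G w x / w x y}

/-- `D_w = sup_{x, y ∼ x} deg(x)/w_{xy}`. -/
def Dw : ℝ := sSup (degWRatios G w)

end WGraph

namespace WGraph

/-- The vertices at graph distance less than `r` from `x₀` (in the component of `x₀`). -/
def openBall {V : Type*} (G : SimpleGraph V) (x₀ : V) (r : ℝ) : Set V :=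
  {x | G.Reachable x₀ x ∧ (G.dist x₀ x : ℝ) < r}

/-- The vertices at graph distance at most `r` from `x₀` (in the component of `x₀`). -/
def closedBall {V : Type*} (G : SimpleGraph V) (x₀ : V) (r : ℝ) : Set V :=
  {x | G.Reachable x₀ x ∧ (G.dist x₀ x : ℝ) ≤ r}

end WGraph

end

/-!
Write `f = √u`, so that `f` solves `∂ₜf = Δf + Γ(f)/f = Δ(f²)/(2f)`, and let
`H = -α Γ(f)/f² - Δf/f`; this is the left-hand side of the estimate, and `H ≤ D_μ` because `f > 0`.

Cut off in space by `φ`, equal to `1` on the ball of radius `R` and decaying linearly to `0` at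
radius `2R`, and maximise `t φ H` over space-time. At a maximum in the interior, vanishing of the
time derivative from the left bounds `t H Δ(f²)` by `f² H + t ∂ₜ(f² H)`, and maximality in space
bounds `Δ(f² H) - H Δ(f²)` by an error of order `f² H D_w D_μ / (φ R)`. The difference
`Δ(f² H) - ∂ₜ(f² H)` is `2 (1 - α) (Γ₂(f) - Γ(f, Γ(f)/f))`, which `CDE(n, -K)` bounds below by
`2 (1 - α) f² H² / n` once `H ≥ K n / (2α)`; solving for `H` gives the estimate.

In the boundary layer `φ ≤ 2/R` one only has `φ H ≤ 2 D_μ / R`, which is good enough if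
`1 - α ≤ n`. For smaller `n`, testing `CDE(n, -K)` on small perturbations of constants at one vertex
gives `2 D_μ ≤ n (K + 2 D_μ)`, and then already `D_μ ≤ K n / (2α)`.
-/

open Set Filter Topology

section Calculus

theorem nonneg_of_hasDerivWithinAt_Iio_of_eventually_le {g : ℝ → ℝ} {g' t : ℝ}
    (hg : HasDerivWithinAt g g' (Iio t) t) (hmax : ∀ᶠ s in 𝓝[<] t, g s ≤ g t) : 0 ≤ g' := by
  refine ge_of_tendsto ((hasDerivWithinAt_iff_tendsto_slope' self_notMem_Iio).1 hg) ?_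
  filter_upwards [hmax, self_mem_nhdsWithin] with s hs hst
  rw [slope_def_field]
  exact div_nonneg_of_nonpos (sub_nonpos.2 hs) (sub_nonpos.2 (le_of_lt hst))

theorem mul_deriv_le_of_eventually_mul_le {H q : ℝ → ℝ} {q' P' t : ℝ}
    (hq : HasDerivAt q q' t) (hqH : HasDerivAt (fun s => q s * H s) P' t)
    (hq_nonneg : ∀ᶠ s in 𝓝[<] t, 0 ≤ q s) (hmax : ∀ᶠ s in 𝓝[<] t, s * H s ≤ t * H t) :
    t * (H t * q') ≤ q t * H t + t * P' := by
  -- Compare `s q(s) H(s)` with `c q(s)`, where `c = t H(t)`: the difference is maximal at `t`.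
  have hderiv : HasDerivAt (fun s => s * (q s * H s) - t * H t * q s)
      (1 * (q t * H t) + t * P' - t * H t * q') t :=
    ((hasDerivAt_id t).mul hqH).sub (hq.const_mul (t * H t))
  have hnonneg := nonneg_of_hasDerivWithinAt_Iio_of_eventually_le hderiv.hasDerivWithinAt <| by
    filter_upwards [hq_nonneg, hmax] with s hqs hs
    linarith [mul_le_mul_of_nonneg_left hs hqs]
  linarith

theorem le_one_add_mul_of_mul_le_mul {a b p q δ : ℝ} (hδ : 0 < δ) (hp : 2 * δ ≤ p)
    (hpq : p - δ ≤ q) (ha : 0 ≤ a) (h : q * b ≤ p * a) : b ≤ (1 + 2 * δ / p) * a := by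
  have hp_pos : 0 < p := by linarith
  have hq_pos : 0 < q := by linarith
  have hratio : p ≤ q * (1 + 2 * δ / p) := by
    calc p ≤ (p - δ) * (1 + 2 * δ / p) := by
          have : (p - δ) * (1 + 2 * δ / p) = p + δ * (p - 2 * δ) / p := by field_simp; ring
          rw [this]
          have : 0 ≤ δ * (p - 2 * δ) / p :=
            div_nonneg (mul_nonneg hδ.le (by linarith)) hp_pos.le
          linarith
      _ ≤ q * (1 + 2 * δ / p) := by gcongr
  refine le_of_mul_le_mul_left ?_ hq_pos
  calc q * b ≤ p * a := h
    _ ≤ q * (1 + 2 * δ / p) * a := mul_le_mul_of_nonneg_right hratio ha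
    _ = q * ((1 + 2 * δ / p) * a) := mul_assoc ..

theorem le_of_mul_le_mul_mul {a b p s t : ℝ} (ha : 0 ≤ a) (hs : 0 < s) (hst : s ≤ t) (hp : 0 < p)
    (hp' : p ≤ 1) (h : t * a ≤ s * (p * b)) : a ≤ b := by
  have hsa : s * (p * a) ≤ s * (p * b) := by
    calc s * (p * a) ≤ s * (1 * a) := by gcongr
      _ ≤ t * a := by rw [one_mul]; gcongr
      _ ≤ s * (p * b) := h
  exact le_of_mul_le_mul_left (le_of_mul_le_mul_left hsa hs) hp

theorem exists_max_finite_prod_Icc {ι : Type*} {S : Set ι} (hS : S.Finite) (hS' : S.Nonempty)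
    {a b : ℝ} (hab : a ≤ b) {F : ι → ℝ → ℝ} (hF : ∀ i ∈ S, ContinuousOn (F i) (Icc a b)) :
    ∃ i ∈ S, ∃ t ∈ Icc a b, ∀ j ∈ S, ∀ s ∈ Icc a b, F j s ≤ F i t := by
  have hmax : ∀ i ∈ S, ∃ t ∈ Icc a b, ∀ s ∈ Icc a b, F i s ≤ F i t := fun i hi =>
    isCompact_Icc.exists_isMaxOn (nonempty_Icc.2 hab) (hF i hi)
  choose! t ht hmax using hmax
  obtain ⟨i, hi, hi_max⟩ := exists_max_image S (fun i => F i (t i)) hS hS'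
  exact ⟨i, hi, t i, ht i hi, fun j hj s hs => (hmax j hj s hs).trans (hi_max j hj)⟩

theorem exists_max_finite_prod_Ioc {ι : Type*} {S : Set ι} (hS : S.Finite) {T M : ℝ} (hT : 0 < T)
    {F : ι → ℝ → ℝ} (hF : ∀ i ∈ S, ContinuousOn (F i) (Ioc 0 T))
    (hM : ∀ i ∈ S, ∀ s ∈ Ioc 0 T, F i s ≤ s * M) {i₀ : ι} (hi₀ : i₀ ∈ S) (hpos : 0 < F i₀ T) :
    ∃ i ∈ S, ∃ t ∈ Ioc 0 T, ∀ j ∈ S, ∀ s ∈ Ioc 0 T, F j s ≤ F i t := by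
  have hFM : F i₀ T ≤ T * M := hM i₀ hi₀ T (right_mem_Ioc.2 hT)
  have hM_pos : 0 < M := pos_of_mul_pos_right (hpos.trans_le hFM) hT.le
  -- Before time `τ` the bound `s * M` keeps `F` below its value at `(i₀, T)`.
  set τ := F i₀ T / M
  have hτ : 0 < τ := div_pos hpos hM_pos
  have hτT : τ ≤ T := (div_le_iff₀ hM_pos).2 hFM
  have hIcc : Icc τ T ⊆ Ioc 0 T := fun s hs => ⟨hτ.trans_le hs.1, hs.2⟩
  obtain ⟨i, hi, t, ht, hmax⟩ := exists_max_finite_prod_Icc hS ⟨i₀, hi₀⟩ hτT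
    fun i hi => (hF i hi).mono hIcc
  refine ⟨i, hi, t, hIcc ht, fun j hj s hs => ?_⟩
  rcases le_total s τ with hsτ | hsτ
  · calc F j s ≤ s * M := hM j hj s hs
      _ ≤ F i₀ T := (le_div_iff₀ hM_pos).1 hsτ
      _ ≤ F i t := hmax i₀ hi₀ T (right_mem_Icc.2 hτT)
  · exact hmax j hj s ⟨hsτ, hs.2⟩

end Calculus

namespace WGraph

section Balls

variable {V : Type*} {G : SimpleGraph V} {x₀ x y : V} {r R : ℝ}

theorem dist_le_dist_add_one_of_adj (h : G.Adj x y) :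
    (G.dist x₀ y : ℝ) ≤ G.dist x₀ x + 1 := by
  have := h.reachable.dist_triangle_right x₀
  rw [SimpleGraph.dist_eq_one_iff_adj.2 h] at this
  exact_mod_cast this

theorem mem_openBall_of_adj (hx : x ∈ openBall G x₀ r) (h : G.Adj x y) :
    y ∈ openBall G x₀ (r + 1) :=
  ⟨hx.1.trans h.reachable, by linarith [hx.2, dist_le_dist_add_one_of_adj (x₀ := x₀) h]⟩

theorem openBall_mono (h : r ≤ R) : openBall G x₀ r ⊆ openBall G x₀ R := fun _ hx =>
  ⟨hx.1, hx.2.trans_le h⟩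

theorem closedBall_subset_openBall (h : r < R) : closedBall G x₀ r ⊆ openBall G x₀ R :=
  fun _ hx => ⟨hx.1, hx.2.trans_lt h⟩

theorem finite_setOf_exists_walk_length_eq [G.LocallyFinite] (x : V) (m : ℕ) :
    {y | ∃ p : G.Walk x y, p.length = m}.Finite := by
  induction m generalizing x with
  | zero =>
    refine (finite_singleton x).subset ?_
    rintro y ⟨p, hp⟩
    exact (p.eq_of_length_eq_zero hp).symm
  | succ m ih =>
    refine ((G.neighborFinset x).finite_toSet.biUnion fun z _ => ih z).subset ?_
    rintro y ⟨_ | ⟨hadj, p⟩, hp⟩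
    · simp at hp
    · exact mem_biUnion (by simpa using hadj) ⟨p, by simpa using hp⟩

theorem finite_openBall [G.LocallyFinite] (x₀ : V) (r : ℝ) : (openBall G x₀ r).Finite := by
  refine ((finite_Iio ⌈r⌉₊).biUnion fun m _ =>
    finite_setOf_exists_walk_length_eq (G := G) x₀ m).subset ?_
  rintro x ⟨hreach, hdist⟩
  exact mem_biUnion (Nat.lt_ceil.2 hdist) hreach.exists_walk_length_eq_dist

/-- The cut-off function of the maximum principle: `1` on the ball of radius `R` around `x₀`, with
linear decay to `0` at distance `2R`. It is negative further out, where it is never used. -/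
noncomputable def cutoff (G : SimpleGraph V) (x₀ : V) (R : ℝ) (x : V) : ℝ :=
  min 1 ((2 * R - G.dist x₀ x) / R)

theorem cutoff_le_one (x : V) : cutoff G x₀ R x ≤ 1 := min_le_left _ _

theorem cutoff_eq_one (hR : 0 < R) (hx : x ∈ closedBall G x₀ R) : cutoff G x₀ R x = 1 :=
  min_eq_left <| (le_div_iff₀ hR).2 <| by linarith [hx.2]

theorem cutoff_nonneg (hR : 0 < R) (hx : x ∈ openBall G x₀ (2 * R)) : 0 ≤ cutoff G x₀ R x :=
  le_min zero_le_one (div_nonneg (by linarith [hx.2]) hR.le)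

theorem two_div_lt_cutoff (hR : 2 < R) (hx : x ∈ openBall G x₀ (2 * R - 2)) :
    2 / R < cutoff G x₀ R x := by
  have hR_pos : 0 < R := by linarith
  exact lt_min ((div_lt_one hR_pos).2 hR)
    ((div_lt_div_iff_of_pos_right hR_pos).2 (by linarith [hx.2]))

theorem cutoff_le_two_div (hR : 0 < R) (hx : x ∈ openBall G x₀ (2 * R))
    (hx' : x ∉ openBall G x₀ (2 * R - 2)) : cutoff G x₀ R x ≤ 2 / R := by
  have hdist : 2 * R - 2 ≤ G.dist x₀ x := not_lt.1 fun h => hx' ⟨hx.1, h⟩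
  exact (min_le_right _ _).trans ((div_le_div_iff_of_pos_right hR).2 (by linarith))

theorem cutoff_sub_le_of_adj (hR : 0 < R) (h : G.Adj x y) :
    cutoff G x₀ R x - 1 / R ≤ cutoff G x₀ R y := by
  refine le_min ?_ ?_
  · linarith [cutoff_le_one (G := G) (x₀ := x₀) (R := R) x, one_div_pos.2 hR]
  · calc cutoff G x₀ R x - 1 / R ≤ (2 * R - G.dist x₀ x) / R - 1 / R :=
          sub_le_sub_right (min_le_right _ _) _
      _ = (2 * R - (G.dist x₀ x + 1)) / R := by ring
      _ ≤ (2 * R - G.dist x₀ y) / R := by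
          gcongr
          exact dist_le_dist_add_one_of_adj h

theorem exists_max_mul_cutoff_mul [G.LocallyFinite] (hR : 0 < R) {T M : ℝ} (hT : 0 < T)
    {H : ℝ → V → ℝ}
    (hcont : ∀ y ∈ openBall G x₀ (2 * R - 2), ContinuousOn (fun s => H s y) (Ioc 0 T))
    (hM : ∀ s ∈ Ioc 0 T, ∀ y, H s y ≤ M) (hx : x ∈ closedBall G x₀ R) (hpos : 0 < H T x)
    (hlt : 2 * M / R < H T x) :
    2 < R ∧ ∃ y ∈ openBall G x₀ (2 * R - 2), ∃ t ∈ Ioc 0 T,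
      T * H T x ≤ t * (cutoff G x₀ R y * H t y) ∧
      ∀ z ∈ openBall G x₀ (2 * R), ∀ s ∈ Ioc 0 T,
        s * (cutoff G x₀ R z * H s z) ≤ t * (cutoff G x₀ R y * H t y) := by
  have hHM : H T x ≤ M := hM T (right_mem_Ioc.2 hT) x
  have hM_pos : 0 < M := hpos.trans_le hHM
  have hR2 : 2 < R := by
    have : 2 * M < R * M := by linarith [(div_lt_iff₀' hR).1 (hlt.trans_le hHM)]
    exact lt_of_mul_lt_mul_right this hM_pos.le
  have hball : openBall G x₀ (2 * R - 2) ⊆ openBall G x₀ (2 * R) := openBall_mono (by linarith)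
  have hx_mem : x ∈ openBall G x₀ (2 * R - 2) := closedBall_subset_openBall (by linarith) hx
  have hval : T * (cutoff G x₀ R x * H T x) = T * H T x := by rw [cutoff_eq_one hR hx, one_mul]
  have hbound : ∀ z ∈ openBall G x₀ (2 * R), ∀ s ∈ Ioc 0 T,
      s * (cutoff G x₀ R z * H s z) ≤ s * (cutoff G x₀ R z * M) := fun z hz s hs =>
    mul_le_mul_of_nonneg_left
      (mul_le_mul_of_nonneg_left (hM s hs z) (cutoff_nonneg hR hz)) hs.1.le
  obtain ⟨y, hy, t, ht, hmax⟩ := exists_max_finite_prod_Ioc (finite_openBall x₀ (2 * R - 2)) hT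
    (F := fun y s => s * (cutoff G x₀ R y * H s y))
    (fun y hy => continuousOn_id.mul ((hcont y hy).const_mul _))
    (fun z hz s hs => (hbound z (hball hz) s hs).trans <| mul_le_mul_of_nonneg_left
      (mul_le_of_le_one_left hM_pos.le (cutoff_le_one z)) hs.1.le)
    hx_mem (hval ▸ mul_pos hT hpos)
  have hge : T * H T x ≤ t * (cutoff G x₀ R y * H t y) :=
    hval ▸ hmax x hx_mem T (right_mem_Ioc.2 hT)
  refine ⟨hR2, y, hy, t, ht, hge, fun z hz s hs => ?_⟩
  by_cases hz' : z ∈ openBall G x₀ (2 * R - 2)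
  · exact hmax z hz' s hs
  · calc s * (cutoff G x₀ R z * H s z) ≤ s * (cutoff G x₀ R z * M) := hbound z hz s hs
      _ ≤ T * (2 / R * M) := mul_le_mul hs.2
          (mul_le_mul_of_nonneg_right (cutoff_le_two_div hR hz hz') hM_pos.le)
          (mul_nonneg (cutoff_nonneg hR hz) hM_pos.le) hT.le
      _ = T * (2 * M / R) := by ring
      _ ≤ T * H T x := mul_le_mul_of_nonneg_left hlt.le hT.le
      _ ≤ t * (cutoff G x₀ R y * H t y) := hge

end Balls

section Operators

variable {V : Type*} {G : SimpleGraph V} [G.LocallyFinite] {w : V → V → ℝ} {μ : V → ℝ}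

/-- The weighted neighbour sum `(1/μ(x)) ∑_{y ∼ x} w_{xy} g(y)`, a positive operator through which
`Δ`, `Γ` and `deg/μ` are all expressed. -/
noncomputable def nbrSum (G : SimpleGraph V) [G.LocallyFinite] (w : V → V → ℝ) (μ : V → ℝ)
    (g : V → ℝ) (x : V) : ℝ :=
  (1 / μ x) * ∑ y ∈ G.neighborFinset x, w x y * g y

/-- The nonlinear operator `Δf + Γ(f)/f`, equal to `Δ(f²)/(2f)` where `f ≠ 0`; it generates the
evolution of the square root of a solution of the heat equation. -/
noncomputable def sqrtLap (G : SimpleGraph V) [G.LocallyFinite] (w : V → V → ℝ) (μ : V → ℝ)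
    (f : V → ℝ) (x : V) : ℝ :=
  lap G w μ f x + Gam G w μ f f x / f x

/-- The Li–Yau quantity `-α Γ(f)/f² - Δf/f`. For `f = √u` with `∂ₜu = Δu` it equals
`(1 - α) Γ(√u)/u - ∂ₜ√u/√u`. -/
noncomputable def liYau (G : SimpleGraph V) [G.LocallyFinite] (w : V → V → ℝ) (μ : V → ℝ) (α : ℝ)
    (f : V → ℝ) (x : V) : ℝ :=
  -(α * (Gam G w μ f f x / f x ^ 2)) - lap G w μ f x / f x

theorem nbrSum_congr {g h : V → ℝ} {x : V} (hgh : ∀ y, G.Adj x y → g y = h y) :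
    nbrSum G w μ g x = nbrSum G w μ h x := by
  unfold nbrSum
  congr 1
  exact Finset.sum_congr rfl fun y hy => by rw [hgh y ((G.mem_neighborFinset x y).1 hy)]

theorem nbrSum_const (c : ℝ) (x : V) : nbrSum G w μ (fun _ => c) x = deg G w x / μ x * c := by
  rw [nbrSum, deg, ← Finset.sum_mul]
  ring

theorem nbrSum_eq_of_adj {x y : V} (hxy : G.Adj x y) {g : V → ℝ} (hg : ∀ z, z ≠ x → g z = 0) :
    nbrSum G w μ g y = w y x / μ y * g x := by
  rw [nbrSum, Finset.sum_eq_single x (fun z _ hz => by rw [hg z hz, mul_zero])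
    fun h => absurd ((G.mem_neighborFinset y x).2 hxy.symm) h]
  ring

theorem lap_eq_nbrSum (f : V → ℝ) (x : V) :
    lap G w μ f x = nbrSum G w μ (fun y => f y - f x) x := rfl

theorem lap_eq_nbrSum_sub (f : V → ℝ) (x : V) :
    lap G w μ f x = nbrSum G w μ f x - deg G w x / μ x * f x := by
  simp only [lap, nbrSum, deg, mul_sub, Finset.sum_sub_distrib, ← Finset.sum_mul]
  ring

theorem Gam_eq_nbrSum (f g : V → ℝ) (x : V) :
    Gam G w μ f g x = 1 / 2 * nbrSum G w μ (fun y => (f y - f x) * (g y - g x)) x := rfl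

theorem lap_mul_sub_mul (a b : ℝ) (g h : V → ℝ) (x : V) :
    lap G w μ (fun y => a * g y - b * h y) x = a * lap G w μ g x - b * lap G w μ h x := by
  simp only [lap, Finset.mul_sum, ← Finset.sum_sub_distrib]
  exact Finset.sum_congr rfl fun y _ => by ring

theorem lap_sq (f : V → ℝ) (x : V) :
    lap G w μ (fun y => f y ^ 2) x = 2 * f x * lap G w μ f x + 2 * Gam G w μ f f x := by
  simp only [lap, Gam, Finset.mul_sum, ← Finset.sum_add_distrib]
  exact Finset.sum_congr rfl fun y _ => by ring

theorem lap_sq_eq_mul_sqrtLap {f : V → ℝ} {x : V} (hf : f x ≠ 0) :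
    lap G w μ (fun y => f y ^ 2) x = 2 * f x * sqrtLap G w μ f x := by
  rw [lap_sq, sqrtLap]
  field_simp

theorem sq_mul_liYau {f : V → ℝ} {x : V} (hf : f x ≠ 0) (α : ℝ) :
    f x ^ 2 * liYau G w μ α f x
      = (1 - α) * Gam G w μ f f x - 1 / 2 * lap G w μ (fun y => f y ^ 2) x := by
  rw [liYau, lap_sq]
  field_simp
  ring

theorem two_mul_Gam2Tilde (f : V → ℝ) (x : V) :
    2 * Gam2Tilde G w μ f x
      = lap G w μ (Gam G w μ f f) x - 2 * Gam G w μ f (sqrtLap G w μ f) x := by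
  have hsplit : Gam G w μ f (sqrtLap G w μ f) x = Gam G w μ f (lap G w μ f) x
      + Gam G w μ f (fun y => Gam G w μ f f y / f y) x := by
    simp only [Gam, sqrtLap, Finset.mul_sum, ← Finset.sum_add_distrib]
    exact Finset.sum_congr rfl fun y _ => by ring
  rw [Gam2Tilde, Gam2, hsplit]
  ring

theorem two_mul_Gam2Tilde_eq_nbrSum (f : V → ℝ) (x : V) :
    2 * Gam2Tilde G w μ f x = nbrSum G w μ (fun y => Gam G w μ f f y - Gam G w μ f f x
      - (f y - f x) * (sqrtLap G w μ f y - sqrtLap G w μ f x)) x := by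
  have hmul : ∀ a b c : ℝ, a * b - 2 * (1 / 2 * (a * c)) = a * (b - c) := fun a b c => by ring
  rw [two_mul_Gam2Tilde, lap, Gam.eq_def G w μ f (sqrtLap G w μ f), hmul,
    ← Finset.sum_sub_distrib, nbrSum]
  simp only [← mul_sub]

theorem two_mul_Gam2Tilde_eq_lap_sq_mul_liYau {f : V → ℝ} (hf : ∀ y, f y ≠ 0) (α : ℝ) (x : V) :
    (1 - α) * (2 * Gam2Tilde G w μ f x)
      = lap G w μ (fun y => f y ^ 2 * liYau G w μ α f y) x
        - ((1 - α) * (2 * Gam G w μ f (sqrtLap G w μ f) x)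
          - 1 / 2 * lap G w μ (lap G w μ fun y => f y ^ 2) x) := by
  simp only [fun y => sq_mul_liYau (G := G) (w := w) (μ := μ) (hf y) α]
  rw [two_mul_Gam2Tilde, lap_mul_sub_mul]
  ring

theorem deg_div_le_Dmu (hDμ : BddAbove (degMuRatios G w μ)) (x : V) :
    deg G w x / μ x ≤ Dmu G w μ :=
  le_csSup hDμ ⟨x, rfl⟩

theorem nbrSum_le_of_lap_nonpos (hDμ : BddAbove (degMuRatios G w μ)) {f : V → ℝ} {x : V}
    (hf : 0 ≤ f x) (hlap : lap G w μ f x ≤ 0) : nbrSum G w μ f x ≤ Dmu G w μ * f x := by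
  rw [lap_eq_nbrSum_sub] at hlap
  linarith [mul_le_mul_of_nonneg_right (deg_div_le_Dmu hDμ x) hf]

end Operators

section Positivity

variable {V : Type*} {G : SimpleGraph V} [G.LocallyFinite] {w : V → V → ℝ} {μ : V → ℝ}
  (hw : ∀ x y, G.Adj x y → 0 < w x y) (hμ : ∀ x, 0 < μ x)

include hw

theorem deg_nonneg (x : V) : 0 ≤ deg G w x :=
  Finset.sum_nonneg fun y hy => (hw x y ((G.mem_neighborFinset x y).1 hy)).le

theorem weight_le_deg {x y : V} (h : G.Adj x y) : w x y ≤ deg G w x :=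
  Finset.single_le_sum (f := w x)
    (fun z hz => (hw x z ((G.mem_neighborFinset x z).1 hz)).le) ((G.mem_neighborFinset x y).2 h)

theorem Dw_nonneg : 0 ≤ Dw G w :=
  Real.sSup_nonneg <| by
    rintro _ ⟨x, y, hxy, rfl⟩
    exact div_nonneg (deg_nonneg hw x) (hw x y hxy).le

theorem deg_le_Dw_mul (hDw : BddAbove (degWRatios G w)) {x y : V} (h : G.Adj x y) :
    deg G w x ≤ Dw G w * w x y :=
  (div_le_iff₀ (hw x y h)).1 (le_csSup hDw ⟨x, y, h, rfl⟩)

include hμ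

theorem nbrSum_mono {g h : V → ℝ} {x : V} (hgh : ∀ y, G.Adj x y → g y ≤ h y) :
    nbrSum G w μ g x ≤ nbrSum G w μ h x := by
  refine mul_le_mul_of_nonneg_left (Finset.sum_le_sum fun y hy => ?_) (one_div_pos.2 (hμ x)).le
  have hxy := (G.mem_neighborFinset x y).1 hy
  exact mul_le_mul_of_nonneg_left (hgh y hxy) (hw x y hxy).le

theorem nbrSum_nonneg {g : V → ℝ} {x : V} (hg : ∀ y, G.Adj x y → 0 ≤ g y) :
    0 ≤ nbrSum G w μ g x := by
  simpa [nbrSum_const] using nbrSum_mono hw hμ hg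

theorem Gam_self_nonneg (f : V → ℝ) (x : V) : 0 ≤ Gam G w μ f f x :=
  mul_nonneg one_half_pos.le (nbrSum_nonneg hw hμ fun _ _ => mul_self_nonneg _)

theorem Dmu_nonneg : 0 ≤ Dmu G w μ :=
  Real.sSup_nonneg <| by
    rintro _ ⟨x, rfl⟩
    exact div_nonneg (deg_nonneg hw x) (hμ x).le

theorem liYau_le_Dmu (hDμ : BddAbove (degMuRatios G w μ)) {α : ℝ} (hα : 0 ≤ α) {f : V → ℝ}
    (hf : ∀ y, 0 < f y) (x : V) : liYau G w μ α f x ≤ Dmu G w μ := by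
  have hlap : -(lap G w μ f x / f x) ≤ deg G w x / μ x := by
    rw [← neg_div, div_le_iff₀ (hf x), lap_eq_nbrSum_sub]
    linarith [nbrSum_nonneg hw hμ (g := f) (x := x) fun y _ => (hf y).le]
  have hGam : 0 ≤ α * (Gam G w μ f f x / f x ^ 2) :=
    mul_nonneg hα (div_nonneg (Gam_self_nonneg hw hμ f x) (sq_nonneg _))
  rw [liYau]
  linarith [deg_div_le_Dmu hDμ x]

theorem apply_le_Dw_mul_of_lap_nonpos (hDw : BddAbove (degWRatios G w)) {f : V → ℝ}
    (hf : ∀ y, 0 ≤ f y) {x y : V} (hlap : lap G w μ f x ≤ 0) (hxy : G.Adj x y) :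
    f y ≤ Dw G w * f x := by
  have hsum : ∑ z ∈ G.neighborFinset x, w x z * f z ≤ deg G w x * f x := by
    rw [lap_eq_nbrSum_sub, nbrSum, one_div_mul_eq_div, div_mul_eq_mul_div] at hlap
    exact (div_le_div_iff_of_pos_right (hμ x)).1 (sub_nonpos.1 hlap)
  refine le_of_mul_le_mul_left ?_ (hw x y hxy)
  calc w x y * f y ≤ ∑ z ∈ G.neighborFinset x, w x z * f z :=
        Finset.single_le_sum (f := fun z => w x z * f z)
          (fun z hz => mul_nonneg (hw x z ((G.mem_neighborFinset x z).1 hz)).le (hf z))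
          ((G.mem_neighborFinset x y).2 hxy)
    _ ≤ deg G w x * f x := hsum
    _ ≤ Dw G w * w x y * f x := mul_le_mul_of_nonneg_right (deg_le_Dw_mul hw hDw hxy) (hf x)
    _ = w x y * (Dw G w * f x) := by ring

theorem lap_neg_of_liYau_pos {α : ℝ} (hα : 0 ≤ α) {f : V → ℝ} {x : V} (hf : 0 < f x)
    (hH : 0 < liYau G w μ α f x) : lap G w μ f x < 0 := by
  have hGam : 0 ≤ α * (Gam G w μ f f x / f x ^ 2) :=
    mul_nonneg hα (div_nonneg (Gam_self_nonneg hw hμ f x) (sq_nonneg _))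
  rw [liYau] at hH
  exact neg_of_div_neg_left (by linarith) hf.le

theorem nbrSum_sq_le_of_lap_nonpos (hDμ : BddAbove (degMuRatios G w μ))
    (hDw : BddAbove (degWRatios G w)) {f : V → ℝ} (hf : ∀ y, 0 ≤ f y) {x : V}
    (hlap : lap G w μ f x ≤ 0) :
    nbrSum G w μ (fun y => f y ^ 2) x ≤ Dw G w * Dmu G w μ * f x ^ 2 := by
  have hDw_nonneg := Dw_nonneg hw
  calc nbrSum G w μ (fun y => f y ^ 2) x
      ≤ nbrSum G w μ (fun y => Dw G w * f x * f y) x := nbrSum_mono hw hμ fun y hy => by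
        rw [sq]
        exact mul_le_mul_of_nonneg_right
          (apply_le_Dw_mul_of_lap_nonpos hw hμ hDw hf hlap hy) (hf y)
    _ = Dw G w * f x * nbrSum G w μ f x := by
        simp only [nbrSum, Finset.mul_sum]
        exact Finset.sum_congr rfl fun y _ => by ring
    _ ≤ Dw G w * f x * (Dmu G w μ * f x) :=
        mul_le_mul_of_nonneg_left (nbrSum_le_of_lap_nonpos hDμ (hf x) hlap)
          (mul_nonneg hDw_nonneg (hf x))
    _ = Dw G w * Dmu G w μ * f x ^ 2 := by ring

theorem lap_sq_mul_le (hDμ : BddAbove (degMuRatios G w μ)) (hDw : BddAbove (degWRatios G w))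
    {f : V → ℝ} (hf : ∀ y, 0 ≤ f y) {x : V} (hlap : lap G w μ f x ≤ 0) {H : V → ℝ} {c : ℝ}
    (hc : 0 ≤ c) (hH : ∀ y, G.Adj x y → H y ≤ H x + c) :
    lap G w μ (fun y => f y ^ 2 * H y) x
      ≤ H x * lap G w μ (fun y => f y ^ 2) x + c * (Dw G w * Dmu G w μ * f x ^ 2) := by
  calc lap G w μ (fun y => f y ^ 2 * H y) x
      ≤ nbrSum G w μ (fun y => H x * (f y ^ 2 - f x ^ 2) + c * f y ^ 2) x :=
        nbrSum_mono hw hμ fun y hy => by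
          linarith [mul_le_mul_of_nonneg_left (hH y hy) (sq_nonneg (f y))]
    _ = H x * lap G w μ (fun y => f y ^ 2) x + c * nbrSum G w μ (fun y => f y ^ 2) x := by
        simp only [nbrSum, lap, Finset.mul_sum, ← Finset.sum_add_distrib]
        exact Finset.sum_congr rfl fun y _ => by ring
    _ ≤ _ := by
        have := nbrSum_sq_le_of_lap_nonpos hw hμ hDμ hDw hf hlap
        gcongr

end Positivity

section Peak

variable {V : Type*} [DecidableEq V] {G : SimpleGraph V} [G.LocallyFinite] {w : V → V → ℝ}
  {μ : V → ℝ} {x y : V} {ε : ℝ}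

/-- The function `1 + ε δ_x`, a test function for `CDE`. -/
def peak (x : V) (ε : ℝ) : V → ℝ := Function.update 1 x (1 + ε)

theorem peak_self : peak x ε x = 1 + ε := Function.update_self ..

theorem peak_of_ne (h : y ≠ x) : peak x ε y = 1 := Function.update_of_ne h ..

theorem peak_pos (hε : 0 < ε) (y : V) : 0 < peak x ε y := by
  rcases eq_or_ne y x with rfl | h
  · rw [peak_self]; positivity
  · rw [peak_of_ne h]; exact one_pos

theorem lap_peak_self : lap G w μ (peak x ε) x = -(ε * (deg G w x / μ x)) := by
  rw [lap_eq_nbrSum, nbrSum_congr (h := fun _ => -ε), nbrSum_const]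
  · ring
  · intro y hy
    rw [peak_self, peak_of_ne hy.ne']
    ring

theorem Gam_peak_self : Gam G w μ (peak x ε) (peak x ε) x = ε ^ 2 / 2 * (deg G w x / μ x) := by
  rw [Gam_eq_nbrSum, nbrSum_congr (h := fun _ => ε ^ 2), nbrSum_const]
  · ring
  · intro y hy
    rw [peak_self, peak_of_ne hy.ne']
    ring

theorem lap_peak_of_adj (h : G.Adj x y) : lap G w μ (peak x ε) y = ε * (w y x / μ y) := by
  rw [lap_eq_nbrSum, nbrSum_eq_of_adj h, peak_self, peak_of_ne h.ne']
  · ring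
  · intro z hz
    rw [peak_of_ne hz, peak_of_ne h.ne', sub_self]

theorem Gam_peak_of_adj (h : G.Adj x y) :
    Gam G w μ (peak x ε) (peak x ε) y = ε ^ 2 / 2 * (w y x / μ y) := by
  rw [Gam_eq_nbrSum, nbrSum_eq_of_adj h, peak_self, peak_of_ne h.ne']
  · ring
  · intro z hz
    rw [peak_of_ne hz, peak_of_ne h.ne', sub_self, mul_zero]

theorem two_mul_Gam2Tilde_peak_le (hw : ∀ x y, G.Adj x y → 0 < w x y) (hμ : ∀ x, 0 < μ x)
    (hDμ : BddAbove (degMuRatios G w μ)) (hε : 0 < ε) :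
    2 * Gam2Tilde G w μ (peak x ε) x
      ≤ deg G w x / μ x * (ε ^ 2 * ((2 + ε / 2) * Dmu G w μ)) := by
  rw [two_mul_Gam2Tilde_eq_nbrSum, ← nbrSum_const]
  refine nbrSum_mono hw hμ fun y hy => ?_
  have hD : 0 ≤ deg G w x / μ x := div_nonneg (deg_nonneg hw x) (hμ x).le
  have hDM : deg G w x / μ x ≤ Dmu G w μ := deg_div_le_Dmu hDμ x
  have hqM : w y x / μ y ≤ Dmu G w μ :=
    (div_le_div_of_nonneg_right (weight_le_deg hw hy.symm) (hμ y).le).trans (deg_div_le_Dmu hDμ y)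
  rw [sqrtLap, sqrtLap, lap_peak_self, lap_peak_of_adj hy, Gam_peak_self, Gam_peak_of_adj hy,
    peak_self, peak_of_ne hy.ne']
  generalize deg G w x / μ x = D, w y x / μ y = q, Dmu G w μ = M at *
  calc ε ^ 2 / 2 * q - ε ^ 2 / 2 * D
        - (1 - (1 + ε)) * (ε * q + ε ^ 2 / 2 * q / 1 - (-(ε * D) + ε ^ 2 / 2 * D / (1 + ε)))
      = ε ^ 2 * ((3 / 2 + ε / 2) * q + 1 / 2 * D) - ε ^ 3 / 2 * D / (1 + ε) := by ring
    _ ≤ ε ^ 2 * ((3 / 2 + ε / 2) * q + 1 / 2 * D) := sub_le_self _ (by positivity)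
    _ ≤ ε ^ 2 * ((3 / 2 + ε / 2) * M + 1 / 2 * M) := by gcongr
    _ = ε ^ 2 * ((2 + ε / 2) * M) := by ring

end Peak

section Curvature

variable {V : Type*} {G : SimpleGraph V} [G.LocallyFinite] {w : V → V → ℝ} {μ : V → ℝ}
  (hw : ∀ x y, G.Adj x y → 0 < w x y) (hμ : ∀ x, 0 < μ x)
  {n K α : ℝ} (hn : 0 < n) (hCDE : CDE G w μ n (-K))

include hw hμ hn hCDE

theorem CDE.two_mul_deg_div_le (hDμ : BddAbove (degMuRatios G w μ)) {x : V}
    (hx : 0 < deg G w x / μ x) : 2 * (deg G w x / μ x) ≤ n * (K + 2 * Dmu G w μ) := by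
  classical
  have hpeak : ∀ ε > 0, 2 * (deg G w x / μ x) ≤ n * (K + (2 + ε / 2) * Dmu G w μ) := by
    intro ε hε
    have hupper := two_mul_Gam2Tilde_peak_le (x := x) hw hμ hDμ hε
    have hlower := hCDE x (peak x ε) (peak_pos hε) <| by
      rw [lap_peak_self]
      exact neg_neg_of_pos (mul_pos hε hx)
    rw [lap_peak_self, Gam_peak_self] at hlower
    generalize deg G w x / μ x = D, Dmu G w μ = M at *
    have hcancel : ε ^ 2 * D * (2 * D / n) ≤ ε ^ 2 * D * (K + (2 + ε / 2) * M) := by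
      linarith [show 1 / n * (-(ε * D)) ^ 2 = ε ^ 2 * D * (2 * D / n) / 2 by ring]
    exact (div_le_iff₀' hn).1 (le_of_mul_le_mul_left hcancel (by positivity))
  have hlim : Tendsto (fun ε : ℝ => n * (K + (2 + ε / 2) * Dmu G w μ)) (𝓝[>] 0)
      (𝓝 (n * (K + 2 * Dmu G w μ))) := by
    have hcont : Continuous fun ε : ℝ => n * (K + (2 + ε / 2) * Dmu G w μ) := by fun_prop
    simpa using (hcont.tendsto 0).mono_left nhdsWithin_le_nhds
  exact ge_of_tendsto hlim (eventually_mem_nhdsWithin.mono hpeak)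

theorem CDE.two_mul_Dmu_le (hK : 0 ≤ K) (hDμ : BddAbove (degMuRatios G w μ)) :
    2 * Dmu G w μ ≤ n * (K + 2 * Dmu G w μ) := by
  have hM := Dmu_nonneg hw hμ
  have hnonneg : 0 ≤ n * (K + 2 * Dmu G w μ) := by positivity
  suffices Dmu G w μ ≤ n * (K + 2 * Dmu G w μ) / 2 by linarith
  refine Real.sSup_le ?_ (div_nonneg hnonneg zero_le_two)
  rintro _ ⟨x, rfl⟩
  rcases (div_nonneg (deg_nonneg hw x) (hμ x).le).eq_or_lt with h | h
  · rw [← h]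
    exact div_nonneg hnonneg zero_le_two
  · linarith [CDE.two_mul_deg_div_le hw hμ hn hCDE hDμ h]

theorem CDE.Dmu_le_of_le_one_sub (hK : 0 ≤ K) (hDμ : BddAbove (degMuRatios G w μ)) (hα : 0 < α)
    (hnα : n ≤ 1 - α) : Dmu G w μ ≤ K * n / (2 * α) := by
  rw [le_div_iff₀ (by positivity)]
  linarith [CDE.two_mul_Dmu_le hw hμ hn hCDE hK hDμ,
    mul_le_mul_of_nonneg_right hnα (Dmu_nonneg hw hμ)]

theorem CDE.sq_mul_liYau_sq_le_Gam2Tilde (hα : 0 < α) {f : V → ℝ} (hf : ∀ y, 0 < f y) {x : V}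
    (hlap : lap G w μ f x < 0)
    (hHK : K * n / (2 * α) ≤ liYau G w μ α f x) :
    f x ^ 2 * (liYau G w μ α f x ^ 2 / n) ≤ Gam2Tilde G w μ f x := by
  refine le_trans ?_ (hCDE x f hf hlap)
  have hfx := (hf x).ne'
  set a := Gam G w μ f f x / f x ^ 2 with ha_def
  set H := liYau G w μ α f x with hH_def
  have ha : 0 ≤ a := div_nonneg (Gam_self_nonneg hw hμ f x) (sq_nonneg _)
  have hGam : Gam G w μ f f x = f x ^ 2 * a :=
    (mul_div_cancel₀ _ (pow_ne_zero 2 hfx)).symm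
  have hlap_eq : lap G w μ f x = -(f x * (H + α * a)) := by
    rw [hH_def, liYau, ← ha_def, neg_sub_left, neg_add_rev]
    field_simp
    ring
  have hK_le : K ≤ 2 * α * H / n := by
    rw [le_div_iff₀ hn]
    linarith [(div_le_iff₀ (by positivity)).1 hHK]
  calc f x ^ 2 * (H ^ 2 / n)
      ≤ f x ^ 2 * (H ^ 2 / n + a * (2 * α * H / n - K) + α ^ 2 * a ^ 2 / n) := by
        have : 0 ≤ a * (2 * α * H / n - K) := mul_nonneg ha (sub_nonneg.2 hK_le)
        have : 0 ≤ α ^ 2 * a ^ 2 / n := by positivity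
        gcongr
        linarith
    _ = 1 / n * lap G w μ f x ^ 2 + -K * Gam G w μ f f x := by
        rw [hlap_eq, hGam]
        ring

end Curvature

section Evolution

variable {V : Type*} {G : SimpleGraph V} [G.LocallyFinite] {w : V → V → ℝ} {μ : V → ℝ}
  {f : ℝ → V → ℝ} {x : V} {t : ℝ}

theorem hasDerivAt_lap {f' : V → ℝ} (hx : HasDerivAt (fun s => f s x) (f' x) t)
    (hnbr : ∀ y, G.Adj x y → HasDerivAt (fun s => f s y) (f' y) t) :
    HasDerivAt (fun s => lap G w μ (f s) x) (lap G w μ f' x) t :=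
  (HasDerivAt.fun_sum fun y hy =>
    ((hnbr y ((G.mem_neighborFinset x y).1 hy)).sub hx).const_mul (w x y)).const_mul _

theorem hasDerivAt_Gam_self {f' : V → ℝ} (hx : HasDerivAt (fun s => f s x) (f' x) t)
    (hnbr : ∀ y, G.Adj x y → HasDerivAt (fun s => f s y) (f' y) t) :
    HasDerivAt (fun s => Gam G w μ (f s) (f s) x) (2 * Gam G w μ (f t) f' x) t := by
  have hdiff : ∀ y ∈ G.neighborFinset x,
      HasDerivAt (fun s => f s y - f s x) (f' y - f' x) t := fun y hy =>
    (hnbr y ((G.mem_neighborFinset x y).1 hy)).sub hx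
  refine (((HasDerivAt.fun_sum fun y hy =>
    ((hdiff y hy).fun_mul (hdiff y hy)).const_mul (w x y)).const_mul (1 / μ x)).const_mul
      (1 / 2)).congr_deriv ?_
  simp only [Gam, Finset.mul_sum]
  exact Finset.sum_congr rfl fun y _ => by ring

theorem hasDerivAt_sq_of_sqrtLap (hf : f t x ≠ 0)
    (hx : HasDerivAt (fun s => f s x) (sqrtLap G w μ (f t) x) t) :
    HasDerivAt (fun s => f s x ^ 2) (lap G w μ (fun y => f t y ^ 2) x) t :=
  (hx.fun_pow 2).congr_deriv <| by simp [lap_sq_eq_mul_sqrtLap hf]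

variable (hx : HasDerivAt (fun s => f s x) (sqrtLap G w μ (f t) x) t)
  (hnbr : ∀ y, G.Adj x y → HasDerivAt (fun s => f s y) (sqrtLap G w μ (f t) y) t)

include hx hnbr

theorem continuousAt_liYau (hf : f t x ≠ 0) (α : ℝ) :
    ContinuousAt (fun s => liYau G w μ α (f s) x) t := by
  have hGam := (hasDerivAt_Gam_self (w := w) (μ := μ) hx hnbr).continuousAt
  have hlap := (hasDerivAt_lap (w := w) (μ := μ) hx hnbr).continuousAt
  exact ((hGam.div (hx.continuousAt.pow 2) (pow_ne_zero 2 hf)).const_mul α).neg.sub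
    (hlap.div hx.continuousAt hf)

theorem hasDerivAt_sq_mul_liYau (hf : ∀ y, f t y ≠ 0) (α : ℝ) :
    HasDerivAt (fun s => f s x ^ 2 * liYau G w μ α (f s) x)
      ((1 - α) * (2 * Gam G w μ (f t) (sqrtLap G w μ (f t)) x)
        - 1 / 2 * lap G w μ (lap G w μ fun y => f t y ^ 2) x) t := by
  have hlap : HasDerivAt (fun s => lap G w μ (fun y => f s y ^ 2) x)
      (lap G w μ (lap G w μ fun y => f t y ^ 2) x) t :=
    hasDerivAt_lap (f := fun s y => f s y ^ 2) (hasDerivAt_sq_of_sqrtLap (hf x) hx)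
      fun y hy => hasDerivAt_sq_of_sqrtLap (hf y) (hnbr y hy)
  refine (((hasDerivAt_Gam_self hx hnbr).const_mul (1 - α)).sub
    (hlap.const_mul (1 / 2))).congr_of_eventuallyEq ?_
  filter_upwards [hx.continuousAt.eventually_ne (hf x)] with s hs
  exact sq_mul_liYau hs α

end Evolution

section MaximumPrinciple

variable {V : Type*} {G : SimpleGraph V} [G.LocallyFinite] {w : V → V → ℝ} {μ : V → ℝ}
  (hw : ∀ x y, G.Adj x y → 0 < w x y) (hμ : ∀ x, 0 < μ x)
  (hDμ : BddAbove (degMuRatios G w μ)) (hDw : BddAbove (degWRatios G w))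
  {n K α : ℝ} (hn : 0 < n) (hCDE : CDE G w μ n (-K)) (hα₀ : 0 < α) (hα₁ : α < 1)

include hw hμ hDμ hDw hn hCDE hα₀ hα₁

theorem CDE.mul_liYau_le_of_max {f : ℝ → V → ℝ} {t : ℝ} (ht : 0 < t) (hf : ∀ y, 0 < f t y) {x : V}
    (hx : HasDerivAt (fun s => f s x) (sqrtLap G w μ (f t) x) t)
    (hnbr : ∀ y, G.Adj x y → HasDerivAt (fun s => f s y) (sqrtLap G w μ (f t) y) t)
    (htime : ∀ᶠ s in 𝓝[<] t, s * liYau G w μ α (f s) x ≤ t * liYau G w μ α (f t) x)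
    {κ : ℝ} (hκ : 0 ≤ κ)
    (hspace : ∀ y, G.Adj x y → liYau G w μ α (f t) y ≤ (1 + κ) * liYau G w μ α (f t) x)
    (hH : 0 < liYau G w μ α (f t) x) (hHK : K * n / (2 * α) ≤ liYau G w μ α (f t) x) :
    t * liYau G w μ α (f t) x ≤ n / (2 * (1 - α)) * (1 + t * (κ * (Dw G w * Dmu G w μ))) := by
  have hf_ne : ∀ y, f t y ≠ 0 := fun y => (hf y).ne'
  have hα : 0 < 1 - α := sub_pos.2 hα₁
  have hlap := lap_neg_of_liYau_pos hw hμ hα₀.le (hf x) hH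
  have htime' := mul_deriv_le_of_eventually_mul_le (hasDerivAt_sq_of_sqrtLap (hf_ne x) hx)
    (hasDerivAt_sq_mul_liYau hx hnbr hf_ne α) (.of_forall fun s => sq_nonneg _) htime
  have hspace' := lap_sq_mul_le hw hμ hDμ hDw (fun y => (hf y).le) hlap.le
    (c := κ * liYau G w μ α (f t) x) (mul_nonneg hκ hH.le)
    fun y hy => (hspace y hy).trans_eq (by ring)
  have hcurv := CDE.sq_mul_liYau_sq_le_Gam2Tilde hw hμ hn hCDE hα₀ hf hlap hHK
  have hGam2 := two_mul_Gam2Tilde_eq_lap_sq_mul_liYau (G := G) (w := w) (μ := μ) hf_ne α x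
  have hscale : 0 < f t x ^ 2 * liYau G w μ α (f t) x := mul_pos (pow_pos (hf x) 2) hH
  set H := liYau G w μ α (f t) x
  have hmain : f t x ^ 2 * H * (t * H) ≤ f t x ^ 2 * H *
      (n / (2 * (1 - α)) * (1 + t * (κ * (Dw G w * Dmu G w μ)))) := by
    calc f t x ^ 2 * H * (t * H)
        = n / (2 * (1 - α)) * (t * ((1 - α) * (2 * (f t x ^ 2 * (H ^ 2 / n))))) := by field_simp
      _ ≤ n / (2 * (1 - α)) * (t * ((1 - α) * (2 * Gam2Tilde G w μ (f t) x))) := by gcongr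
      _ ≤ n / (2 * (1 - α)) * (f t x ^ 2 * H * (1 + t * (κ * (Dw G w * Dmu G w μ)))) := by
          refine mul_le_mul_of_nonneg_left ?_ (by positivity)
          rw [hGam2]
          linarith [mul_le_mul_of_nonneg_left hspace' ht.le]
      _ = _ := by ring
  exact le_of_mul_le_mul_left hmain hscale

variable {f : ℝ → V → ℝ} {x₀ x : V} {R T : ℝ} (hR : 0 < R) (hT : 0 < T)
  (hf : ∀ t ∈ Ioc 0 T, ∀ y, 0 < f t y)
  (hheat : ∀ y ∈ openBall G x₀ (2 * R), ∀ t ∈ Ioc 0 T,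
    HasDerivAt (fun s => f s y) (sqrtLap G w μ (f t) y) t)
  (hx : x ∈ closedBall G x₀ R)

include hR hT hf hheat hx

theorem CDE.mul_liYau_le_of_lt (hpos : 0 < liYau G w μ α (f T) x)
    (hbdry : 2 * Dmu G w μ / R < liYau G w μ α (f T) x)
    (hcurv : K * n / (2 * α) ≤ liYau G w μ α (f T) x) :
    T * liYau G w μ α (f T) x
      ≤ n / (2 * (1 - α)) * (1 + T * (2 * (1 / R) * (Dw G w * Dmu G w μ))) := by
  have hα : 0 < 1 - α := sub_pos.2 hα₁
  have hM := Dmu_nonneg hw hμ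
  have hD := Dw_nonneg hw
  set H : ℝ → V → ℝ := fun t => liYau G w μ α (f t)
  have hnbr : ∀ y ∈ openBall G x₀ (2 * R - 2), ∀ z, G.Adj y z → z ∈ openBall G x₀ (2 * R) :=
    fun y hy z hz => openBall_mono (by linarith) (mem_openBall_of_adj hy hz)
  have hball : openBall G x₀ (2 * R - 2) ⊆ openBall G x₀ (2 * R) := openBall_mono (by linarith)
  obtain ⟨hR2, y, hy, t, ht, hge, hmax⟩ := exists_max_mul_cutoff_mul hR hT (H := H)
    (fun y hy t ht => (continuousAt_liYau (hheat y (hball hy) t ht)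
      (fun z hz => hheat z (hnbr y hy z hz) t ht) (hf t ht y).ne' α).continuousWithinAt)
    (fun t ht => liYau_le_Dmu hw hμ hDμ hα₀.le (hf t ht)) hx hpos hbdry
  set φ := cutoff G x₀ R
  have hφ : 2 * (1 / R) < φ y := by
    rw [mul_one_div]
    exact two_div_lt_cutoff hR2 hy
  have hφ_pos : 0 < φ y := lt_trans (by positivity) hφ
  have hHy : H T x ≤ H t y := le_of_mul_le_mul_mul hpos.le ht.1 ht.2 hφ_pos (cutoff_le_one y) hge
  have hHy_pos : 0 < H t y := hpos.trans_le hHy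
  have hHt := CDE.mul_liYau_le_of_max hw hμ hDμ hDw hn hCDE hα₀ hα₁ ht.1 (hf t ht)
    (hheat y (hball hy) t ht) (fun z hz => hheat z (hnbr y hy z hz) t ht)
    (by
      filter_upwards [Ioo_mem_nhdsLT ht.1] with s hs
      refine le_of_mul_le_mul_left ?_ hφ_pos
      linarith [hmax y (hball hy) s ⟨hs.1, hs.2.le.trans ht.2⟩])
    (κ := 2 * (1 / R) / φ y) (by positivity)
    (fun z hz => le_one_add_mul_of_mul_le_mul (one_div_pos.2 hR) hφ.le
      (cutoff_sub_le_of_adj hR hz) hHy_pos.le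
      (le_of_mul_le_mul_left (hmax z (hnbr y hy z hz) t ht) ht.1))
    hHy_pos (hcurv.trans hHy)
  calc T * H T x ≤ φ y * (t * H t y) := hge.trans_eq (by ring)
    _ ≤ φ y * (n / (2 * (1 - α)) * (1 + t * (2 * (1 / R) / φ y * (Dw G w * Dmu G w μ)))) :=
        mul_le_mul_of_nonneg_left hHt hφ_pos.le
    _ = n / (2 * (1 - α)) * (φ y + t * (2 * (1 / R) * (Dw G w * Dmu G w μ))) := by field_simp
    _ ≤ n / (2 * (1 - α)) * (1 + T * (2 * (1 / R) * (Dw G w * Dmu G w μ))) := by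
        gcongr
        exacts [cutoff_le_one y, ht.2]

theorem CDE.liYau_le_max :
    liYau G w μ α (f T) x ≤ max (2 * Dmu G w μ / R) (max (K * n / (2 * α))
      (n / ((1 - α) * (2 * T)) + n * Dw G w * Dmu G w μ / ((1 - α) * R))) := by
  by_contra! hlt
  obtain ⟨hbdry, hcurv, hint⟩ := by simpa only [max_lt_iff] using hlt
  have hα : 0 < 1 - α := sub_pos.2 hα₁
  have hM := Dmu_nonneg hw hμ
  have hpos : 0 < liYau G w μ α (f T) x := lt_of_le_of_lt (by positivity) hbdry
  refine hint.not_ge (le_of_mul_le_mul_left ?_ hT)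
  calc T * liYau G w μ α (f T) x
      ≤ n / (2 * (1 - α)) * (1 + T * (2 * (1 / R) * (Dw G w * Dmu G w μ))) :=
        CDE.mul_liYau_le_of_lt hw hμ hDμ hDw hn hCDE hα₀ hα₁ hR hT hf hheat hx hpos hbdry hcurv.le
    _ = T * (n / ((1 - α) * (2 * T)) + n * Dw G w * Dmu G w μ / ((1 - α) * R)) := by field_simp

theorem CDE.liYau_le (hK : 0 ≤ K) :
    liYau G w μ α (f T) x ≤ n / ((1 - α) * (2 * T))
      + n * (2 + Dw G w) * Dmu G w μ / ((1 - α) * R) + K * n / (2 * α) := by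
  have hα : 0 < 1 - α := sub_pos.2 hα₁
  have hM := Dmu_nonneg hw hμ
  have hD := Dw_nonneg hw
  have htime_nonneg : 0 ≤ n / ((1 - α) * (2 * T)) := by positivity
  have hcutoff_nonneg : 0 ≤ n * Dw G w * Dmu G w μ / ((1 - α) * R) := by positivity
  have hbdry_nonneg : 0 ≤ n * 2 * Dmu G w μ / ((1 - α) * R) := by positivity
  have hcurv_nonneg : 0 ≤ K * n / (2 * α) := by positivity
  rw [mul_add, add_mul, add_div]
  rcases le_total n (1 - α) with hn_le | hn_ge
  · have hDmu := CDE.Dmu_le_of_le_one_sub hw hμ hn hCDE hK hDμ hα₀ hn_le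
    linarith [liYau_le_Dmu hw hμ hDμ hα₀.le (hf T (right_mem_Ioc.2 hT)) x]
  · have hbdry : 2 * Dmu G w μ / R ≤ n * 2 * Dmu G w μ / ((1 - α) * R) := by
      rw [div_le_div_iff₀ hR (mul_pos hα hR)]
      nlinarith [mul_le_mul_of_nonneg_right hn_ge (by positivity : 0 ≤ 2 * Dmu G w μ * R)]
    refine (CDE.liYau_le_max hw hμ hDμ hDw hn hCDE hα₀ hα₁ hR hT hf hheat hx).trans ?_
    refine max_le ?_ (max_le ?_ ?_) <;> linarith

end MaximumPrinciple

section SquareRoot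

variable {V : Type*} {G : SimpleGraph V} [G.LocallyFinite] {w : V → V → ℝ} {μ : V → ℝ}
  {u : V → ℝ → ℝ} {x : V} {t : ℝ} (hu : ∀ y, 0 < u y t)
  (hheat : HasDerivAt (fun s => u x s) (lap G w μ (fun y => u y t) x) t)

include hu hheat

theorem hasDerivAt_sqrt_of_heat :
    HasDerivAt (fun s => √(u x s)) (sqrtLap G w μ (fun y => √(u y t)) x) t := by
  refine (hheat.sqrt (hu x).ne').congr_deriv ?_
  have hsq : (fun y => u y t) = fun y => √(u y t) ^ 2 :=
    funext fun y => (Real.sq_sqrt (hu y).le).symm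
  have hsqrt : √(u x t) ≠ 0 := (Real.sqrt_pos.2 (hu x)).ne'
  rw [hsq, lap_sq_eq_mul_sqrtLap (f := fun y => √(u y t)) hsqrt]
  field_simp

theorem liYau_sqrt_of_heat (α : ℝ) :
    liYau G w μ α (fun y => √(u y t)) x
      = (1 - α) * Gam G w μ (fun y => √(u y t)) (fun y => √(u y t)) x / u x t
        - deriv (fun s => √(u x s)) t / √(u x t) := by
  rw [(hasDerivAt_sqrt_of_heat hu hheat).deriv, liYau, sqrtLap, Real.sq_sqrt (hu x).le, add_div,
    div_div, Real.mul_self_sqrt (hu x).le]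
  ring

end SquareRoot

end WGraph

theorem corollary2_general {V : Type*} (G : SimpleGraph V) [G.LocallyFinite]
    (w : V → V → ℝ) (hw : ∀ x y, G.Adj x y → 0 < w x y)
    (μ : V → ℝ) (hμ : ∀ x, 0 < μ x)
    (hDμ : BddAbove (WGraph.degMuRatios G w μ))
    (hDw : BddAbove (WGraph.degWRatios G w))
    (n K : ℝ) (hn : 0 < n) (hK : 0 ≤ K)
    (hCDE : WGraph.CDE G w μ n (-K))
    (x₀ : V) (R : ℝ) (hR : 0 < R) (T : ℝ)
    (u : V → ℝ → ℝ) (hu : ∀ x, ∀ t ∈ Ioc 0 T, 0 < u x t)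
    (hheat : ∀ x ∈ WGraph.openBall G x₀ (2 * R), ∀ t ∈ Ioc 0 T,
      HasDerivAt (fun s => u x s) (WGraph.lap G w μ (fun y => u y t) x) t)
    (α : ℝ) (hα₀ : 0 < α) (hα₁ : α < 1) :
    ∀ x ∈ WGraph.closedBall G x₀ R, ∀ t ∈ Ioc 0 T,
      (1 - α) * WGraph.Gam G w μ (fun y => √(u y t)) (fun y => √(u y t)) x / u x t
          - deriv (fun s => √(u x s)) t / √(u x t)
        ≤ min (WGraph.Dmu G w μ)
            (n / ((1 - α) * (2 * t))
              + n * (2 + WGraph.Dw G w) * WGraph.Dmu G w μ / ((1 - α) * R)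
              + K * n / (2 * α)) := by
  intro x hx t ht
  have hx_open : x ∈ WGraph.openBall G x₀ (2 * R) :=
    WGraph.closedBall_subset_openBall (by linarith) hx
  have hpos : ∀ s ∈ Ioc 0 T, ∀ y, 0 < √(u y s) := fun s hs y => Real.sqrt_pos.2 (hu y s hs)
  have hsub : Ioc 0 t ⊆ Ioc 0 T := Ioc_subset_Ioc_right ht.2
  rw [← WGraph.liYau_sqrt_of_heat (fun y => hu y t ht) (hheat x hx_open t ht) α]
  refine le_min (WGraph.liYau_le_Dmu hw hμ hDμ hα₀.le (hpos t ht) x) ?_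
  exact WGraph.CDE.liYau_le hw hμ hDμ hDw hn hCDE hα₀ hα₁ hR ht.1
    (f := fun s y => √(u y s)) (fun s hs => hpos s (hsub hs))
    (fun y hy s hs => WGraph.hasDerivAt_sqrt_of_heat (fun z => hu z s (hsub hs))
      (hheat y hy s (hsub hs))) hx hK

theorem corollary2 {V : Type*} (G : SimpleGraph V) [G.LocallyFinite]
    (w : V → V → ℝ) (hw : ∀ x y, G.Adj x y → 0 < w x y)
    (μ : V → ℝ) (hμ : ∀ x, 0 < μ x)
    (hDμ : BddAbove (WGraph.degMuRatios G w μ))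
    (hDw : BddAbove (WGraph.degWRatios G w))
    (n K : ℝ) (hn : 0 < n) (hK : 0 < K)
    (hCDE : WGraph.CDE G w μ n (-K))
    (x₀ : V) (R : ℝ) (hR : 1 < R)
    (u : V → ℝ → ℝ) (hu : ∀ x t, 0 < t → 0 < u x t)
    (hheat : ∀ x ∈ WGraph.openBall G x₀ (2 * R), ∀ t : ℝ, 0 < t →
      HasDerivAt (fun s => u x s) (WGraph.lap G w μ (fun y => u y t) x) t)
    (α : ℝ) (hα₀ : 0 < α) (hα₁ : α < 1) :
    ∀ x ∈ WGraph.closedBall G x₀ R, ∀ t : ℝ, 0 < t →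
      (1 - α) * WGraph.Gam G w μ (fun y => √(u y t)) (fun y => √(u y t)) x / u x t
          - deriv (fun s => √(u x s)) t / √(u x t)
        ≤ min (WGraph.Dmu G w μ)
            (n / ((1 - α) * (2 * t))
              + n * (2 + WGraph.Dw G w) * WGraph.Dmu G w μ / ((1 - α) * R)
              + K * n / (2 * α)) := fun x hx t ht =>
  corollary2_general G w hw μ hμ hDμ hDw n K hn hK.le hCDE x₀ R (zero_lt_one.trans hR) t u
    (fun x s hs => hu x s hs.1) (fun x hx s hs => hheat x hx s hs.1) α hα₀ hα₁ x hx t ⟨ht, le_rfl⟩
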